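/- Let $k$ be a field and let $A$ be a finite-dimensional (unital, associative) $k$-algebra. Let $\operatorname{gldim} A$ denote the global dimension of $A$, i.e. the supremum of the projective dimensions of the finitely generated left $A$-modules, and let $\operatorname{domdim} A\in\mathbb{N}\cup\{\infty\}$ denote the dominant dimension of $A$, i.e. the supremum of all $n\ge 0$ such that the terms $I_0,\dots,I_{n-1}$ of a minimal injective coresolution $0\to A\to I_0\to I_1\to\cdots$ of the left $A$-module $A$ are projective. Suppose that $A$ is a higher Auslander algebra, i.e. that there is an integer $n\ge 2$ with $\operatorname{gldim} A\le n\le\operatorname{domdim} A$, and let $g=\operatorname{gldim} A$. For a finitely generated left $A$-module $M$ put $(-)^{*}=\operatorname{Hom}_A(-,A)$ and let $t(M)$ be the kernel of the canonical evaluation map $M\to M^{**}$, $m\mapsto(f\mapsto f(m))$. A torsion $A$-module is a module isomorphic to $t(M)$ for some finitely generated left $A$-module $M$. Then every nonzero torsion $A$-module has projective dimension equal to $g$. -/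

import Mathlib

universe u

open CategoryTheory

/-- The canonical evaluation map `f_M : M → M**`, `m ↦ (f ↦ f m)`, for a left `A`-module `M`.
Here `M* = Hom_A(M, A)` is a right `A`-module (a left module over the opposite ring `Aᵐᵒᵖ`), the
action coming from right multiplication on `A`; and `M** = Hom_{Aᵐᵒᵖ}(M*, A)` is again a left
`A`-module, the action coming from left multiplication on `A`. -/
def bidualEval (A : Type u) [Ring A] (M : Type u) [AddCommGroup M] [Module A M] :
    M →ₗ[A] ((M →ₗ[A] A) →ₗ[Aᵐᵒᵖ] A) where
  toFun m :=
    { toFun := fun f => f m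
      map_add' := fun _ _ => rfl
      map_smul' := fun _ _ => rfl }
  map_add' m m' := by
    ext f
    exact map_add f m m'
  map_smul' a m := by
    ext f
    exact map_smul f a m

/-- `t(M)`, the kernel of the evaluation map `M → M**`. -/
def torsionPart (A : Type u) [Ring A] (M : Type u) [AddCommGroup M] [Module A M] :
    Submodule A M :=
  LinearMap.ker (bidualEval A M)

/-- A torsion module is a module isomorphic to `t(M)` for some finitely generated module `M`. -/
def IsTorsionModule (A : Type u) [Ring A] (N : Type u) [AddCommGroup N] [Module A N] : Prop :=
  ∃ M : ModuleCat.{u} A, Module.Finite A M ∧ Nonempty (N ≃ₗ[A] torsionPart A M)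

/-- The global dimension: the supremum of the projective dimensions of the finitely generated
left `A`-modules. The zero module has projective dimension `⊥` in Mathlib's convention. -/
noncomputable def globalDimension (A : Type u) [Ring A] : WithBot ℕ∞ :=
  ⨆ M : {M : ModuleCat.{u} A // Module.Finite A M}, projectiveDimension M.1

/-- A submodule is essential if it meets every nonzero submodule nontrivially. -/
def IsEssentialSubmodule {A : Type u} [Ring A] {M : Type u} [AddCommGroup M] [Module A M]
    (E : Submodule A M) : Prop :=
  ∀ U : Submodule A M, U ≠ ⊥ → E ⊓ U ≠ ⊥

/-- A minimal injective coresolution `0 → M → I 0 → I 1 → ⋯`: an exact sequence with all `I n`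
injective in which `I 0` is an injective hull of `M` and `I (n + 1)` is an injective hull of the
image of `I n → I (n + 1)`. -/
structure MinimalInjectiveCoresolution (A : Type u) [Ring A] (M : Type u) [AddCommGroup M]
    [Module A M] where
  I : ℕ → ModuleCat.{u} A
  injective : ∀ n, Module.Injective A (I n)
  ε : M →ₗ[A] I 0
  d : ∀ n, I n →ₗ[A] I (n + 1)
  ε_injective : Function.Injective ε
  exact_zero : Function.Exact ε (d 0)
  exact_succ : ∀ n, Function.Exact (d n) (d (n + 1))
  essential_zero : IsEssentialSubmodule (LinearMap.range ε)
  essential_succ : ∀ n, IsEssentialSubmodule (LinearMap.range (d n))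

/-- The dominant dimension of `M`: the supremum of all `n` such that the terms
`I 0, …, I (n - 1)` of a minimal injective coresolution of `M` are projective. (Minimal injective
coresolutions exist and are unique up to isomorphism, so taking the supremum over all of them as
well makes no difference.) -/
noncomputable def dominantDimension (A : Type u) [Ring A] (M : Type u) [AddCommGroup M]
    [Module A M] : ℕ∞ :=
  ⨆ (R : MinimalInjectiveCoresolution A M) (n : ℕ)
    (_ : ∀ i < n, Module.Projective A (R.I i)), (n : ℕ∞)

/-- `A` is a higher Auslander algebra if `gldim A ≤ n ≤ domdim A` for some `n ≥ 2`. -/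
def IsHigherAuslander (A : Type u) [Ring A] : Prop :=
  ∃ n : ℕ, 2 ≤ n ∧ globalDimension A ≤ (n : WithBot ℕ∞) ∧ (n : ℕ∞) ≤ dominantDimension A A

/-!
Dominant dimension at least `n` gives a coresolution `0 → A → I 0 → ⋯` whose first `n` terms are
both injective and projective. A torsion module `N = t(M)` admits no nonzero map to such a term
`I`: a map `t(M) → I` extends to `M` because `I` is injective, `I` embeds in a free module because
it is projective, and every linear form on `M` kills `t(M)` (`linearMap_torsionPart_eq_zero`).
Dimension shifting along the cosyzygies of the coresolution turns this into `Ext^i(N, A) = 0` for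
all `i < n` (`MinimalInjectiveCoresolution.subsingleton_ext_ker`,
`MinimalInjectiveCoresolution.subsingleton_ext`).

On the other hand, over a Noetherian ring a finitely generated module of finite projective dimension
`d ≥ 0` has `Ext^d(N, A) ≠ 0`: any finitely generated `Y` is a quotient of a finite free module, and
right exactness of `Ext^d(N, -)` would otherwise give `Ext^d(N, Y) = 0`, so that the projective
dimension of `N` would be smaller than `d` (`hasProjectiveDimensionLT_of_subsingleton_ext_self`).
Hence a nonzero torsion module has projective dimension at least `n`. As
`pd N ≤ gldim A ≤ n`, all three numbers agree.
-/

open Abelian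

section FiniteModules

variable {A : Type u} [Ring A]

/-- `Ext^d(N, -)` commutes with finite direct sums. -/
lemma subsingleton_ext_of_finite_free {N : ModuleCat.{u} A} {d : ℕ}
    (h : Subsingleton (Ext N (ModuleCat.of A A) d)) (P : ModuleCat.{u} A)
    [Module.Free A P] [Module.Finite A P] : Subsingleton (Ext N P d) := by
  refine subsingleton_of_forall_eq 0 fun x ↦ ?_
  let b := Module.Free.chooseBasis A P
  have hid : 𝟙 P = ∑ i, ModuleCat.ofHom (b.coord i) ≫
      ModuleCat.ofHom (LinearMap.toSpanSingleton A P (b i)) := by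
    ext y
    simp [ModuleCat.hom_sum, b.sum_repr]
  rw [← Ext.comp_mk₀_id x, hid, Ext.mk₀_sum, Ext.comp_sum]
  refine Finset.sum_eq_zero fun i _ ↦ ?_
  rw [← Ext.mk₀_comp_mk₀, ← Ext.comp_assoc_of_second_deg_zero, h.elim (x.comp _ _) 0,
    Ext.zero_comp]

variable [IsNoetherianRing A]

/-- Over a Noetherian ring, the projective dimension of a finitely generated module is detected by
`Ext` into finitely generated modules. -/
lemma hasProjectiveDimensionLT_of_subsingleton_ext_of_finite (N : ModuleCat.{u} A)
    [Module.Finite A N] (d : ℕ)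
    (h : ∀ Y : ModuleCat.{u} A, Module.Finite A Y → Subsingleton (Ext N Y d)) :
    HasProjectiveDimensionLT N d := by
  induction d generalizing N with
  | zero =>
    have : Subsingleton (N ⟶ N) := Ext.homEquiv₀.subsingleton_congr.mp (h N ‹_›)
    exact ((Limits.IsZero.iff_id_eq_zero N).mpr
      (Subsingleton.elim _ _)).hasProjectiveDimensionLT_zero
  | succ d ih =>
    obtain ⟨m, f, hf⟩ := Module.Finite.exists_fin' A N
    have hS := LinearMap.shortExact_shortComplexKer hf
    cases d with
    | zero =>
      rw [zero_add, ← projective_iff_hasProjectiveDimensionLT_one]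
      -- The presentation of `N` splits, because its class in `Ext¹` vanishes.
      have : Subsingleton (Ext N f.shortComplexKer.X₁ 1) :=
        h f.shortComplexKer.X₁ inferInstance
      obtain ⟨s, hs⟩ := Ext.covariant_sequence_exact₃ N hS (Ext.mk₀ (𝟙 N)) (zero_add 1)
        (Subsingleton.elim _ _)
      obtain ⟨s, rfl⟩ := (Ext.mk₀_bijective _ _).2 s
      rw [Ext.mk₀_comp_mk₀, (Ext.mk₀_bijective _ _).1.eq_iff] at hs
      exact (Retract.mk s f.shortComplexKer.g hs).projective
    | succ d =>
      rw [hS.hasProjectiveDimensionLT_X₃_iff d inferInstance]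
      refine ih f.shortComplexKer.X₁ fun Y hY ↦ subsingleton_of_forall_eq 0 fun x ↦ ?_
      obtain ⟨y, rfl⟩ := Ext.contravariant_sequence_exact₁ hS Y x (add_comm 1 (d + 1))
        ((h Y hY).elim _ _)
      rw [Ext.eq_zero_of_projective y, Ext.comp_zero]

/-- A finitely generated module `N` over a Noetherian ring with `pd N ≤ d` and `Ext^d(N, A) = 0`
has `pd N < d`, because `Ext^d(N, -)` is right exact. -/
lemma hasProjectiveDimensionLT_of_subsingleton_ext_self (N : ModuleCat.{u} A)
    [Module.Finite A N] (d : ℕ) [HasProjectiveDimensionLE N d]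
    (h : Subsingleton (Ext N (ModuleCat.of A A) d)) : HasProjectiveDimensionLT N d := by
  refine hasProjectiveDimensionLT_of_subsingleton_ext_of_finite N d fun Y hY ↦ ?_
  obtain ⟨m, f, hf⟩ := Module.Finite.exists_fin' A Y
  refine subsingleton_of_forall_eq 0 fun x ↦ ?_
  obtain ⟨y, rfl⟩ := Ext.covariant_sequence_exact₃ N (LinearMap.shortExact_shortComplexKer hf) x
    rfl (Ext.eq_zero_of_hasProjectiveDimensionLT _ (d + 1) le_rfl)
  rw [(subsingleton_ext_of_finite_free h f.shortComplexKer.X₂).elim y 0, Ext.zero_comp]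

end FiniteModules

section Torsion

variable {A : Type u} [Ring A]

/-- A map from `t(M)` to an injective module extends to `M`; if the target is also projective, hence
a submodule of a free module, the extension is a family of linear forms, which vanish on `t(M)`. -/
lemma linearMap_torsionPart_eq_zero {M : Type u} [AddCommGroup M] [Module A M]
    {I : Type u} [AddCommGroup I] [Module A I] [Module.Injective A I] [Module.Projective A I]
    (f : torsionPart A M →ₗ[A] I) : f = 0 := by
  obtain ⟨F, hF⟩ := Module.Injective.out (torsionPart A M).subtype
    (torsionPart A M).injective_subtype f
  obtain ⟨s, hs⟩ := Module.projective_def'.mp ‹Module.Projective A I›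
  ext x
  have hx : s (F x) = 0 := Finsupp.ext fun i ↦
    LinearMap.congr_fun (LinearMap.mem_ker.mp x.2) (Finsupp.lapply i ∘ₗ s ∘ₗ F)
  have := LinearMap.congr_fun hs (F x)
  rw [LinearMap.comp_apply, hx, map_zero] at this
  exact (hF x).symm.trans this.symm

lemma IsTorsionModule.subsingleton_linearMap {N : Type u} [AddCommGroup N] [Module A N]
    (hN : IsTorsionModule A N) (I : Type u) [AddCommGroup I] [Module A I]
    [Module.Injective A I] [Module.Projective A I] : Subsingleton (N →ₗ[A] I) := by
  obtain ⟨M, -, ⟨e⟩⟩ := hN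
  refine subsingleton_of_forall_eq 0 fun f ↦ LinearMap.ext fun x ↦ ?_
  simpa using LinearMap.congr_fun (linearMap_torsionPart_eq_zero (f ∘ₗ e.symm.toLinearMap)) (e x)

lemma IsTorsionModule.finite [IsNoetherianRing A] {N : Type u} [AddCommGroup N] [Module A N]
    (hN : IsTorsionModule A N) : Module.Finite A N := by
  obtain ⟨M, _, ⟨e⟩⟩ := hN
  exact Module.Finite.equiv e.symm

end Torsion

namespace MinimalInjectiveCoresolution

variable {A : Type u} [Ring A] {M : Type u} [AddCommGroup M] [Module A M]
  (R : MinimalInjectiveCoresolution A M)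

/-- The short complex `ker (d j) → I j → ker (d (j + 1))`. -/
abbrev cosyzygyComplex (j : ℕ) : ShortComplex (ModuleCat.{u} A) :=
  .mk (ModuleCat.ofHom (LinearMap.ker (R.d j)).subtype)
    (ModuleCat.ofHom ((R.d j).codRestrict (LinearMap.ker (R.d (j + 1)))
      fun x ↦ (R.exact_succ j).apply_apply_eq_zero x))
    (ModuleCat.hom_ext <| LinearMap.ext fun x : LinearMap.ker (R.d j) ↦
      (Subtype.ext x.2 : (⟨R.d j x, _⟩ : LinearMap.ker (R.d (j + 1))) = 0))

lemma cosyzygyComplex_shortExact (j : ℕ) : (R.cosyzygyComplex j).ShortExact where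
  exact := by
    refine (ShortComplex.ShortExact.moduleCat_exact_iff_function_exact _).mpr fun x ↦ ?_
    exact ⟨fun h ↦ ⟨⟨x, congrArg Subtype.val h⟩, rfl⟩, by rintro ⟨y, rfl⟩; exact Subtype.ext y.2⟩
  mono_f := (ModuleCat.mono_iff_injective _).mpr (Submodule.injective_subtype _)
  epi_g := (ModuleCat.epi_iff_surjective _).mpr fun ⟨y, hy⟩ ↦ by
    obtain ⟨x, rfl⟩ := (R.exact_succ j y).mp hy
    exact ⟨x, rfl⟩

/-- If `N` has no nonzero map to `I 0, …, I (n - 1)`, then `Ext^i(N, -)` vanishes on the `j`-th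
cosyzygy of `M` whenever `i + j < n`. -/
lemma subsingleton_ext_ker {N : ModuleCat.{u} A} {n : ℕ}
    (hN : ∀ j < n, Subsingleton (N →ₗ[A] R.I j)) (i j : ℕ) (hij : i + j < n) :
    Subsingleton (Ext N (ModuleCat.of A (LinearMap.ker (R.d j))) i) := by
  induction i generalizing j with
  | zero =>
    rw [Ext.homEquiv₀.subsingleton_congr]
    refine ⟨fun f g ↦ ModuleCat.hom_ext <| LinearMap.ext fun x ↦ Subtype.ext ?_⟩
    exact LinearMap.congr_fun ((hN j (by lia)).elim
      ((LinearMap.ker (R.d j)).subtype ∘ₗ f.hom) ((LinearMap.ker (R.d j)).subtype ∘ₗ g.hom)) x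
  | succ i ih =>
    have : Injective (R.cosyzygyComplex j).X₂ :=
      (Module.injective_iff_injective_object A (R.I j)).mp (R.injective j)
    refine subsingleton_of_forall_eq 0 fun x ↦ ?_
    obtain ⟨y, rfl⟩ := Ext.covariant_sequence_exact₁ N (R.cosyzygyComplex_shortExact j) x
      (Ext.eq_zero_of_injective _) rfl
    rw [(ih (j + 1) (by lia)).elim y 0, Ext.zero_comp]

lemma subsingleton_ext {N : ModuleCat.{u} A} {n : ℕ}
    (hN : ∀ j < n, Subsingleton (N →ₗ[A] R.I j)) (i : ℕ) (hi : i < n) :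
    Subsingleton (Ext N (ModuleCat.of A M) i) := by
  have e : M ≃ₗ[A] LinearMap.ker (R.d 0) := (LinearEquiv.ofInjective R.ε R.ε_injective).trans
    (LinearEquiv.ofEq _ _ (LinearMap.exact_iff.mp R.exact_zero).symm)
  have := R.subsingleton_ext_ker hN i 0 hi
  refine subsingleton_of_forall_eq 0 fun x ↦ ?_
  rw [← Ext.comp_mk₀_id x, ← e.toModuleIso.hom_inv_id, ← Ext.mk₀_comp_mk₀,
    ← Ext.comp_assoc_of_second_deg_zero]
  exact (congrArg (fun z ↦ Ext.comp z _ _) (this.elim _ 0)).trans (Ext.zero_comp ..)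

end MinimalInjectiveCoresolution

/-- The supremum defining the dominant dimension is attained up to any finite bound. For `n = 0` this
would need the existence of minimal injective coresolutions. -/
lemma exists_coresolution_of_le_dominantDimension {A : Type u} [Ring A] {M : Type u}
    [AddCommGroup M] [Module A M] {n : ℕ} (hn : 0 < n)
    (h : (n : ℕ∞) ≤ dominantDimension A M) :
    ∃ R : MinimalInjectiveCoresolution A M, ∀ i < n, Module.Projective A (R.I i) := by
  have h' : ((n - 1 : ℕ) : ℕ∞) < dominantDimension A M :=
    lt_of_lt_of_le (by exact_mod_cast Nat.sub_lt hn one_pos) h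
  simp only [dominantDimension, lt_iSup_iff, Nat.cast_lt] at h'
  obtain ⟨R, m, hm, hlt⟩ := h'
  exact ⟨R, fun i hi ↦ hm i (by lia)⟩

theorem corollary4p7 {k : Type*} [Field k] {A : Type u} [Ring A] [Algebra k A]
    [Module.Finite k A] (hA : IsHigherAuslander A)
    (g : ℕ) (hg : globalDimension A = (g : WithBot ℕ∞))
    (N : Type u) [AddCommGroup N] [Module A N] [Nontrivial N] (hN : IsTorsionModule A N) :
    projectiveDimension (ModuleCat.of A N) = (g : WithBot ℕ∞) := by
  obtain ⟨n, hn, hgn, hdom⟩ := hA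
  obtain ⟨R, hR⟩ := exists_coresolution_of_le_dominantDimension (by lia) hdom
  have : IsNoetherianRing A := IsNoetherianRing.of_finite k A
  have := hN.finite
  have hle : projectiveDimension (ModuleCat.of A N) ≤ (g : WithBot ℕ∞) := by
    rw [← hg]
    exact le_iSup (fun M : {M : ModuleCat.{u} A // Module.Finite A M} ↦ projectiveDimension M.1)
      ⟨ModuleCat.of A N, this⟩
  have hext := R.subsingleton_ext (N := ModuleCat.of A N) (n := n) fun j hj ↦ by
    have := R.injective j
    have := hR j hj
    exact hN.subsingleton_linearMap _
  -- Starting from `pd N ≤ n - 1`, the vanishing of `Ext` lowers the bound until `N = 0`.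
  have hge : ¬ HasProjectiveDimensionLT (ModuleCat.of A N) n := by
    intro h
    have hdown : ∀ d ≤ n, HasProjectiveDimensionLT (ModuleCat.of A N) (n - d) := by
      intro d hd
      induction d with
      | zero => exact h
      | succ d ih =>
        have hd' : n - d = n - (d + 1) + 1 := by lia
        have : HasProjectiveDimensionLE (ModuleCat.of A N) (n - (d + 1)) := by
          rw [HasProjectiveDimensionLE, ← hd']
          exact ih (by lia)
        exact hasProjectiveDimensionLT_of_subsingleton_ext_self _ _ (hext _ (by lia))
    have h0 := hdown n le_rfl
    rw [Nat.sub_self, hasProjectiveDimensionLT_zero_iff_isZero,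
      ModuleCat.isZero_iff_subsingleton] at h0
    exact not_subsingleton N h0
  rw [← projectiveDimension_ge_iff] at hge
  exact le_antisymm hle ((hg ▸ hgn).trans hge)
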